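/- For real $x>0$ let $\zeta_a(s,x)=\sum_{m=0}^{\infty}\frac{(-1)^m}{(m+x)^s}$ be the alternating Hurwitz zeta function (the series converges, as a limit of partial sums, for $\operatorname{Re}s>0$ and is analytic in $s$ there), let $\zeta(s,x)$ be the Hurwitz zeta function, i.e. the analytic continuation in $s$ of $\sum_{m\ge 0}(m+x)^{-s}$, and let the generalised Stieltjes constants $\gamma_p(x)$ be defined by the Laurent expansion $\zeta(s,x)=\frac1{s-1}+\sum_{p=0}^{\infty}\frac{(-1)^p}{p!}\gamma_p(x)(s-1)^p$ about $s=1$. Then for every real $x>0$ and every integer $n\ge 0$, with $\zeta_a^{(n)}$ the $n$-th derivative in $s$, $$(-1)^n\,\zeta_a^{(n)}(1,x)=\frac12\sum_{k=0}^{n}\binom nk\log^{n-k}2\left[\gamma_k\!\left(\frac x2\right)-\gamma_k\!\left(\frac{1+x}2\right)\right]=\sum_{i=0}^{\infty}\frac1{2^{i+1}}\sum_{j=0}^{i}\binom ij\frac{(-1)^j\log^n(x+j)}{x+j},$$ where the last series over $i$ converges. In particular, writing $S_n=\sum_{i=0}^{\infty}\frac1{2^{i+1}}\sum_{j=0}^{i}\binom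 ij\frac{(-1)^j\log^n(1+j)}{1+j}$, with $\gamma$ Euler's constant and $\gamma_1=\gamma_1(1)$, $$\log 2=S_0,\qquad \gamma=\frac12\log2-\frac{1}{\log2}S_1,\qquad \gamma_1=-\frac1{12}\log^22+\frac12S_1-\frac1{2\log2}S_2.$$ Here $\log^0 y=1$ for all $y>0$. -/

import Mathlib

open Filter Topology

/-- The Hurwitz zeta function `ζ(s, x)` for real `x > 0`, continued analytically to all complex
`s ≠ 1`. Mathlib's `HurwitzZeta.hurwitzZeta` takes its parameter modulo `1` and is the Hurwitz zeta
function for the representative in `(0, 1]`. Write `x = m + b` with `m : ℕ` and `b ∈ (0, 1]`; then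
`ζ(s, x) = ζ(s, b) - ∑_{j < m} 1 / (j + b) ^ s`. The two lemmas `hasSum_hurwitzZetaPos` and
`differentiableAt_hurwitzZetaPos` characterise this function. -/
noncomputable def hurwitzZetaPos (s : ℂ) (x : ℝ) : ℂ :=
  HurwitzZeta.hurwitzZeta (x : UnitAddCircle) s -
    ∑ j ∈ Finset.range (⌈x⌉₊ - 1),
      1 / ((j : ℂ) + ((x - ((⌈x⌉₊ - 1 : ℕ) : ℝ) : ℝ) : ℂ)) ^ s

/-- For `Re s > 1` and `x > 0`, `ζ(s, x) = ∑ 1 / (n + x) ^ s`. -/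
theorem hasSum_hurwitzZetaPos {s : ℂ} (hs : 1 < s.re) {x : ℝ} (hx : 0 < x) :
    HasSum (fun n : ℕ => 1 / ((n : ℂ) + (x : ℂ)) ^ s) (hurwitzZetaPos s x) := by
  obtain ⟨m, hm⟩ : ∃ m : ℕ, ⌈x⌉₊ - 1 = m := ⟨_, rfl⟩
  have hpos : 0 < ⌈x⌉₊ := Nat.ceil_pos.mpr hx
  have hm' : ⌈x⌉₊ = m + 1 := by omega
  have h1 : x ≤ (m : ℝ) + 1 := by
    have := Nat.le_ceil x
    rw [hm'] at this
    exact_mod_cast this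
  have h2 : (m : ℝ) < x := Nat.lt_ceil.mp (by omega)
  unfold hurwitzZetaPos
  rw [hm]
  have hcoe : ((x : ℝ) : UnitAddCircle) = ((x - (m : ℝ) : ℝ) : UnitAddCircle) := by
    rw [AddCircle.coe_sub]
    have : (((m : ℝ)) : UnitAddCircle) = 0 := by
      have h := AddCircle.coe_nsmul (p := (1 : ℝ)) (n := m) (x := (1 : ℝ))
      rw [nsmul_eq_mul, mul_one] at h
      rw [h, AddCircle.coe_period, smul_zero]
    rw [this, sub_zero]
  rw [hcoe]
  have key := HurwitzZeta.hasSum_hurwitzZeta_of_one_lt_re (a := x - (m : ℝ))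
    ⟨by linarith, by linarith⟩ hs
  rw [← hasSum_nat_add_iff' m] at key
  refine key.congr_fun (fun n => ?_)
  congr 2
  push_cast
  ring

theorem differentiableAt_hurwitzZetaPos_aux {x : ℝ} (hx : 0 < x) (s : ℂ) : DifferentiableAt ℂ (fun s : ℂ => ∑ j ∈ Finset.range (⌈x⌉₊ - 1),
      1 / ((j : ℂ) + ((x - ((⌈x⌉₊ - 1 : ℕ) : ℝ) : ℝ) : ℂ)) ^ s) s := by
  have h2 : ((⌈x⌉₊ - 1 : ℕ) : ℝ) < x := Nat.lt_ceil.mp (by have := Nat.ceil_pos.mpr hx; omega)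
  refine DifferentiableAt.fun_sum (fun j _ => ?_)
  have hne : ((j : ℂ) + ((x - ((⌈x⌉₊ - 1 : ℕ) : ℝ) : ℝ) : ℂ)) ≠ 0 := by
    have : (0 : ℝ) < (j : ℝ) + (x - ((⌈x⌉₊ - 1 : ℕ) : ℝ)) := by
      have : (0 : ℝ) ≤ (j : ℝ) := Nat.cast_nonneg j
      linarith
    exact_mod_cast this.ne'
  refine DifferentiableAt.fun_div (differentiableAt_const _) ?_ ?_
  · exact (differentiableAt_id).const_cpow (Or.inl hne)
  · intro h
    exact hne ((Complex.cpow_eq_zero_iff _ _).mp h).1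

/-- `ζ(s, x)` is analytic in `s ≠ 1`. -/
theorem differentiableAt_hurwitzZetaPos {x : ℝ} {s : ℂ} (hx : 0 < x) (hs : s ≠ 1) :
    DifferentiableAt ℂ (fun s => hurwitzZetaPos s x) s :=
  (HurwitzZeta.differentiableAt_hurwitzZeta _ hs).sub (differentiableAt_hurwitzZetaPos_aux hx s)

/-- The regular part `ζ(s, x) - 1 / (s - 1)` of the Hurwitz zeta function, with its removable
singularity at `s = 1` filled in by the limit. -/
noncomputable def hurwitzZetaRegular (x : ℝ) : ℂ → ℂ :=
  Function.update (fun s => hurwitzZetaPos s x - 1 / (s - 1)) 1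
    (limUnder (𝓝[≠] (1 : ℂ)) (fun s => hurwitzZetaPos s x - 1 / (s - 1)))

theorem differentiable_hurwitzZetaRegular {x : ℝ} (hx : 0 < x) : Differentiable ℂ (hurwitzZetaRegular x) := by
  intro s
  rcases eq_or_ne s 1 with rfl | hs
  · set F : ℂ → ℂ := fun s =>
      (HurwitzZeta.hurwitzZeta (x : UnitAddCircle) s - 1 / (s - 1) / Complex.Gammaℝ s) +
      dslope (fun s => (Complex.Gammaℝ s)⁻¹) 1 s -
      ∑ j ∈ Finset.range (⌈x⌉₊ - 1),
        1 / ((j : ℂ) + ((x - ((⌈x⌉₊ - 1 : ℕ) : ℝ) : ℝ) : ℂ)) ^ s with hF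
    have hFd : DifferentiableAt ℂ F 1 := by
      refine ((HurwitzZeta.differentiableAt_hurwitzZeta_sub_one_div _).add ?_).sub (differentiableAt_hurwitzZetaPos_aux hx 1)
      have : DifferentiableOn ℂ (dslope (fun s => (Complex.Gammaℝ s)⁻¹) 1) Set.univ :=
        (Complex.differentiableOn_dslope univ_mem).2
          Complex.differentiable_Gammaℝ_inv.differentiableOn
      exact this.differentiableAt univ_mem
    have hG : Complex.Gammaℝ 1 = 1 := Complex.Gammaℝ_one
    have heq : ∀ s : ℂ, s ≠ 1 → hurwitzZetaPos s x - 1 / (s - 1) = F s := by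
      intro s hs
      simp only [hF, hurwitzZetaPos]
      rw [dslope_of_ne _ hs, slope_def_field, hG]
      have : s - 1 ≠ 0 := sub_ne_zero.mpr hs
      simp only [inv_one, div_eq_mul_inv, one_mul]
      ring
    have hev : (fun s => hurwitzZetaPos s x - 1 / (s - 1)) =ᶠ[𝓝[≠] (1 : ℂ)] F := by
      filter_upwards [self_mem_nhdsWithin] with s hs using heq s hs
    have hlim : limUnder (𝓝[≠] (1 : ℂ)) (fun s => hurwitzZetaPos s x - 1 / (s - 1)) = F 1 :=
      ((hFd.continuousAt.tendsto.mono_left nhdsWithin_le_nhds).congr' hev.symm).limUnder_eq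
    have : hurwitzZetaRegular x = F := by
      funext s
      unfold hurwitzZetaRegular
      rcases eq_or_ne s 1 with rfl | hs
      · rw [Function.update_self, hlim]
      · rw [Function.update_of_ne hs, heq s hs]
    rw [this]
    exact hFd
  · have h : DifferentiableAt ℂ (fun s => hurwitzZetaPos s x - 1 / (s - 1)) s := by
      refine (differentiableAt_hurwitzZetaPos hx hs).sub ?_
      exact (differentiableAt_const _).div (differentiableAt_id.sub_const 1) (sub_ne_zero.mpr hs)
    refine h.congr_of_eventuallyEq ?_
    filter_upwards [isOpen_ne.mem_nhds hs] with z hz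
    unfold hurwitzZetaRegular
    rw [Function.update_of_ne hz]

/-- The generalised Stieltjes constants `γ_p(x)`: `(-1) ^ p / p! * γ_p(x)` is the coefficient of
`(s - 1) ^ p` in the Laurent expansion of `ζ(s, x)` about `s = 1`; see `hasSum_stieltjes`. -/
noncomputable def stieltjes (p : ℕ) (x : ℝ) : ℂ :=
  (-1) ^ p * iteratedDeriv p (hurwitzZetaRegular x) 1

/-- The Laurent expansion `ζ(s, x) = 1 / (s - 1) + ∑ (-1) ^ p / p! * γ_p(x) * (s - 1) ^ p`. -/
theorem hasSum_stieltjes {x : ℝ} (hx : 0 < x) {s : ℂ} (hs : s ≠ 1) :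
    HasSum (fun p : ℕ => (-1) ^ p / (p.factorial : ℂ) * stieltjes p x * (s - 1) ^ p)
      (hurwitzZetaPos s x - 1 / (s - 1)) := by
  have h := Complex.hasSum_taylorSeries_of_entire (differentiable_hurwitzZetaRegular hx) 1 s
  have e : hurwitzZetaRegular x s = hurwitzZetaPos s x - 1 / (s - 1) := by
    unfold hurwitzZetaRegular
    rw [Function.update_of_ne hs]
  rw [e] at h
  refine h.congr_fun fun p => ?_
  unfold stieltjes
  have : ((-1 : ℂ) ^ p) * (-1) ^ p = 1 := by rw [← mul_pow]; simp
  simp only [smul_eq_mul]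
  linear_combination (exp := 1) ((((p.factorial : ℂ))⁻¹ * iteratedDeriv p (hurwitzZetaRegular x) 1 * (s - 1) ^ p)) * this
/-- The alternating Hurwitz zeta function `ζ_a(s, x) = ∑ (-1) ^ n / (n + x) ^ s`, where the sum is
the limit of the partial sums over `n < N` as `N → ∞`; for `x > 0` it converges when `Re s > 0`. -/
noncomputable def altHurwitzZeta (s : ℂ) (x : ℝ) : ℂ :=
  ∑'[SummationFilter.conditional ℕ] n : ℕ, (-1) ^ n / ((n : ℂ) + (x : ℂ)) ^ s

/-- The `i`-th term `2 ^ (-i-1) * ∑_{j ≤ i} C(i, j) (-1) ^ j log ^ n (x + j) / (x + j)` of the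
Hasse-type series. -/
noncomputable def hasseTerm (n : ℕ) (x : ℝ) (i : ℕ) : ℝ :=
  1 / 2 ^ (i + 1) * ∑ j ∈ Finset.range (i + 1),
    (i.choose j : ℝ) * ((-1) ^ j * Real.log (x + j) ^ n / (x + j))

/-- The combination
`(1/2) * ∑_{k ≤ n} C(n, k) log ^ (n-k) 2 * (γ_k(x/2) - γ_k((1+x)/2))` of Stieltjes constants. -/
noncomputable def stieltjesSum (n : ℕ) (x : ℝ) : ℂ :=
  1 / 2 * ∑ k ∈ Finset.range (n + 1),
    (n.choose k : ℂ) * (Real.log 2 : ℂ) ^ (n - k) * (stieltjes k (x / 2) - stieltjes k ((1 + x) / 2))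

/-! Put q = e^(-t). For Re s > 0 the integral of t^(s-1) e^(-xt) / (1+q) over t > 0 can be evaluated
in two ways. The partial sums of ∑ (-q)^m give Γ(s) times the alternating series
(`tendsto_gamma_mul_alternating`). Since 1+q = 2(1 - (1-q)/2), the expansion 1/(1+q) = ½ ∑
((1-q)/2)^i gives Γ(s) times the Hasse series (`hasSum_gamma_mul_hasseFun`). The latter converges
geometrically and locally uniformly in s, so it may be differentiated termwise at s = 1.

For Re s > 1, splitting into even and odd indices gives ζ_a(s,x) = 2^(-s) (ζ(s,x/2) - ζ(s,(1+x)/2)).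
The poles at 1 cancel, so the identity theorem extends this to Re s > 0 with regular parts in place
of ζ (`altHurwitzZeta_eqOn`), and the Leibniz rule at 1 produces the Stieltjes constants.

The closed forms at x = 1 come from (s-1) ζ_a(s,1) = (1 - 2^(1-s)) (s-1) ζ(s), by comparing
derivatives at 1. -/

/-! ### Mellin integrals and the two expansions of 1 / (1 + e^(-t)). -/

theorem integrableOn_cpow_mul_exp {s : ℂ} (hs : 0 < s.re) {x : ℝ} (hx : 0 < x) :
    MeasureTheory.IntegrableOn (fun t : ℝ => (t : ℂ) ^ (s - 1) * Complex.exp (-(x * t)))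
      (Set.Ioi 0) := by
  have h0 : MeasureTheory.IntegrableOn (fun t : ℝ => t ^ (s.re - 1) * Real.exp (-x * t ^ (1 : ℝ)))
      (Set.Ioi 0) :=
    integrableOn_rpow_mul_exp_neg_mul_rpow (by linarith) one_pos hx
  refine h0.mono' ?_ ?_
  · refine ContinuousOn.aestronglyMeasurable (fun t ht => ?_) measurableSet_Ioi
    refine ContinuousAt.continuousWithinAt (ContinuousAt.mul ?_ (by fun_prop))
    exact Complex.continuous_ofReal.continuousAt.cpow continuousAt_const
      (Complex.ofReal_mem_slitPlane.2 ht)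
  · filter_upwards [MeasureTheory.self_mem_ae_restrict measurableSet_Ioi] with t ht
    rw [norm_mul, Complex.norm_cpow_eq_rpow_re_of_pos ht, Complex.norm_exp]
    simp

theorem norm_integral_cpow_mul_exp {s : ℂ} (hs : 0 < s.re) {x : ℝ} (hx : 0 < x) :
    ∫ t : ℝ in Set.Ioi 0, ‖(t : ℂ) ^ (s - 1) * Complex.exp (-(x * t))‖ =
      (1 / x) ^ s.re * Real.Gamma s.re := by
  rw [← Real.integral_rpow_mul_exp_neg_mul_Ioi hs hx]
  refine MeasureTheory.setIntegral_congr_fun measurableSet_Ioi fun t ht => ?_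
  rw [norm_mul, Complex.norm_cpow_eq_rpow_re_of_pos ht, Complex.norm_exp]
  simp

/-- `∫₀^∞ t ^ (s - 1) e ^ (-x t) p(e ^ (-t)) dt` is `Γ(s) ∑ c_j / (j + x) ^ s` for the polynomial
`p = ∑ c_j X ^ j`. -/
theorem integral_cpow_mul_exp_mul_sum {s : ℂ} (hs : 0 < s.re) {x : ℝ} (hx : 0 < x) (N : ℕ)
    (c : ℕ → ℂ) :
    ∫ t : ℝ in Set.Ioi 0, (t : ℂ) ^ (s - 1) * Complex.exp (-(x * t)) *
        ∑ j ∈ Finset.range N, c j * (Complex.exp (-t)) ^ j =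
      Complex.Gamma s * ∑ j ∈ Finset.range N, c j * (1 / ((j : ℂ) + (x : ℂ)) ^ s) := by
  have key : ∀ j : ℕ, ∀ t : ℝ, (t : ℂ) ^ (s - 1) * Complex.exp (-(x * t)) *
      (c j * (Complex.exp (-t)) ^ j) =
      c j * ((t : ℂ) ^ (s - 1) * Complex.exp (-((j + x : ℝ) * t))) := by
    intro j t
    rw [← Complex.exp_nat_mul]
    have : Complex.exp (-((j + x : ℝ) * t)) = Complex.exp (-(x * t)) * Complex.exp (j * -t) := by
      rw [← Complex.exp_add]; congr 1; push_cast; ring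
    rw [this]; ring
  simp_rw [Finset.mul_sum, key]
  rw [MeasureTheory.integral_finsetSum]
  · refine Finset.sum_congr rfl fun j _ => ?_
    have hj : 0 < (j : ℝ) + x := by positivity
    rw [MeasureTheory.integral_const_mul, Complex.integral_cpow_mul_exp_neg_mul_Ioi hs hj,
      one_div, one_div, Complex.inv_cpow _ _ (by
        rw [Complex.arg_ofReal_of_nonneg hj.le]; exact Real.pi_pos.ne)]
    push_cast
    ring
  · intro j _
    exact (integrableOn_cpow_mul_exp hs (by positivity : 0 < (j : ℝ) + x)).const_mul _

/-- The `i`-th term of the Hasse series of `ζ_a(s, x)`. -/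
noncomputable def hasseFun (x : ℝ) (i : ℕ) (s : ℂ) : ℂ :=
  1 / 2 ^ (i + 1) * ∑ j ∈ Finset.range (i + 1),
    ((i.choose j : ℂ) * (-1) ^ j) * (1 / ((j : ℂ) + (x : ℂ)) ^ s)

/-- The binomial theorem collapses the inner alternating sum to (1 - e^(-t))^i under the integral.
-/
theorem gamma_mul_hasseFun {s : ℂ} (hs : 0 < s.re) {x : ℝ} (hx : 0 < x) (i : ℕ) :
    Complex.Gamma s * hasseFun x i s =
      ∫ t : ℝ in Set.Ioi 0, (t : ℂ) ^ (s - 1) * Complex.exp (-(x * t)) *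
        ((1 / 2) * ((1 - Complex.exp (-t)) / 2) ^ i) := by
  unfold hasseFun
  rw [mul_left_comm, ← integral_cpow_mul_exp_mul_sum hs hx, ← MeasureTheory.integral_const_mul]
  congr 1
  ext t
  have : (1 - Complex.exp (-t)) ^ i =
      ∑ j ∈ Finset.range (i + 1), (i.choose j : ℂ) * (-1) ^ j * Complex.exp (-t) ^ j := by
    rw [sub_eq_neg_add, add_pow]
    refine Finset.sum_congr rfl fun j _ => ?_
    rw [neg_pow (Complex.exp (-t)), one_pow]; ring
  rw [← this, div_pow, pow_succ]
  ring

/-- Uniformity in t is the point: this ratio 1/2 drives the convergence of the Hasse series. -/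
theorem norm_hasse_kernel_le {t : ℝ} (ht : 0 < t) (i : ℕ) :
    ‖(1 / 2 : ℂ) * ((1 - Complex.exp (-t)) / 2) ^ i‖ ≤ 1 / 2 * (1 / 2) ^ i := by
  have h1 : Real.exp (-t) < 1 := by rw [Real.exp_lt_one_iff]; linarith
  have h2 := Real.exp_pos (-t)
  have : (1 - Complex.exp (-t)) / 2 = (((1 - Real.exp (-t)) / 2 : ℝ) : ℂ) := by push_cast; rfl
  rw [this, norm_mul, norm_pow, Complex.norm_real, Real.norm_of_nonneg (by linarith)]
  have h3 : ‖(1 / 2 : ℂ)‖ = 1 / 2 := by norm_num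
  rw [h3]
  gcongr
  · linarith

theorem integrableOn_hasse {s : ℂ} (hs : 0 < s.re) {x : ℝ} (hx : 0 < x) (i : ℕ) :
    MeasureTheory.IntegrableOn (fun t : ℝ => (t : ℂ) ^ (s - 1) * Complex.exp (-(x * t)) *
        ((1 / 2) * ((1 - Complex.exp (-t)) / 2) ^ i)) (Set.Ioi 0) := by
  refine (integrableOn_cpow_mul_exp hs hx).mul_bdd (c := 1 / 2 * (1 / 2) ^ i) ?_ ?_
  · exact Continuous.aestronglyMeasurable (by fun_prop)
  · filter_upwards [MeasureTheory.self_mem_ae_restrict measurableSet_Ioi] with t ht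
      using norm_hasse_kernel_le ht i

theorem integral_norm_hasse_le {s : ℂ} (hs : 0 < s.re) {x : ℝ} (hx : 0 < x) (i : ℕ) :
    ∫ t : ℝ in Set.Ioi 0, ‖(t : ℂ) ^ (s - 1) * Complex.exp (-(x * t)) *
        ((1 / 2) * ((1 - Complex.exp (-t)) / 2) ^ i)‖ ≤
      ((1 / x) ^ s.re * Real.Gamma s.re) * (1 / 2 * (1 / 2) ^ i) := by
  rw [← norm_integral_cpow_mul_exp hs hx, ← MeasureTheory.integral_mul_const]
  refine MeasureTheory.setIntegral_mono_on (integrableOn_hasse hs hx i).norm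
    ((integrableOn_cpow_mul_exp hs hx).norm.mul_const _) measurableSet_Ioi fun t ht => ?_
  rw [norm_mul _ ((1 / 2 : ℂ) * _)]
  exact mul_le_mul_of_nonneg_left (norm_hasse_kernel_le ht i) (norm_nonneg _)

/-- The factor in front of the geometric term is continuous in s, hence bounded on compact sets, as
the Weierstrass M-test needs. -/
theorem norm_hasseFun_le {s : ℂ} (hs : 0 < s.re) {x : ℝ} (hx : 0 < x) (i : ℕ) :
    ‖hasseFun x i s‖ ≤
      ((1 / x) ^ s.re * Real.Gamma s.re) / ‖Complex.Gamma s‖ * (1 / 2 * (1 / 2) ^ i) := by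
  have hG : 0 < ‖Complex.Gamma s‖ := norm_pos_iff.2 (Complex.Gamma_ne_zero_of_re_pos hs)
  rw [div_mul_eq_mul_div, le_div_iff₀ hG, mul_comm, ← norm_mul, gamma_mul_hasseFun hs hx]
  exact (MeasureTheory.norm_integral_le_integral_norm _).trans (integral_norm_hasse_le hs hx i)

theorem hasSum_gamma_mul_hasseFun {s : ℂ} (hs : 0 < s.re) {x : ℝ} (hx : 0 < x) :
    HasSum (fun i => Complex.Gamma s * hasseFun x i s)
      (∫ t : ℝ in Set.Ioi 0, (t : ℂ) ^ (s - 1) * Complex.exp (-(x * t)) *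
        (1 / (1 + Complex.exp (-t)))) := by
  have h := MeasureTheory.hasSum_integral_of_summable_integral_norm
    (μ := MeasureTheory.volume.restrict (Set.Ioi (0 : ℝ))) (integrableOn_hasse hs hx) (by
      refine Summable.of_nonneg_of_le
        (fun i => MeasureTheory.integral_nonneg fun t => norm_nonneg _)
        (integral_norm_hasse_le hs hx) ?_
      exact ((summable_geometric_of_lt_one (by norm_num) (by norm_num)).mul_left _).mul_left _)
  simp_rw [gamma_mul_hasseFun hs hx]
  convert! h using 1
  refine MeasureTheory.setIntegral_congr_fun measurableSet_Ioi fun t ht => ?_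
  have h1 : Real.exp (-t) < 1 := by rw [Real.exp_lt_one_iff]; simpa using ht
  have h2 := Real.exp_pos (-t)
  have e : (1 - Complex.exp (-t)) / 2 = (((1 - Real.exp (-t)) / 2 : ℝ) : ℂ) := by push_cast; rfl
  have h3 : ‖(1 - Complex.exp (-t)) / 2‖ < 1 := by
    rw [e, Complex.norm_real, Real.norm_of_nonneg (by linarith)]
    linarith
  have h4 : (1 + Complex.exp (-t)) ≠ 0 := by
    have : (1 + Real.exp (-t)) ≠ 0 := by positivity
    exact_mod_cast this
  have h5 : 1 - (1 - Complex.exp (-t)) / 2 = (1 + Complex.exp (-t)) / 2 := by ring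
  rw [tsum_mul_left, tsum_mul_left, tsum_geometric_of_norm_lt_one h3, h5]
  congr 1
  field_simp

theorem tendsto_gamma_mul_alternating {s : ℂ} (hs : 0 < s.re) {x : ℝ} (hx : 0 < x) :
    Tendsto (fun N => Complex.Gamma s *
      ∑ m ∈ Finset.range N, (-1 : ℂ) ^ m * (1 / ((m : ℂ) + (x : ℂ)) ^ s)) atTop
      (𝓝 (∫ t : ℝ in Set.Ioi 0, (t : ℂ) ^ (s - 1) * Complex.exp (-(x * t)) *
        (1 / (1 + Complex.exp (-t))))) := by
  simp_rw [← integral_cpow_mul_exp_mul_sum hs hx]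
  have geo : ∀ (t : ℝ) (N : ℕ), ∑ j ∈ Finset.range N, (-1 : ℂ) ^ j * Complex.exp (-t) ^ j =
      (1 - (-Complex.exp (-t)) ^ N) / (1 + Complex.exp (-t)) := by
    intro t N
    have h4 : (1 + Complex.exp (-t)) ≠ 0 := by
      have : (1 + Real.exp (-t)) ≠ 0 := by positivity
      exact_mod_cast this
    have := mul_neg_geom_sum (-Complex.exp (-t)) N
    rw [eq_div_iff h4, ← this, sub_neg_eq_add, mul_comm]
    congr 1
    exact Finset.sum_congr rfl fun j _ => by rw [← mul_pow, neg_one_mul]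
  have hq : ∀ t : ℝ, ‖-Complex.exp (-t)‖ = Real.exp (-t) := by
    intro t; rw [norm_neg, Complex.norm_exp]; simp
  -- The 2 bounds (1 - (-q)^N) / (1 + q) for 0 < q ≤ 1: the numerator has norm at most 2, the
  -- denominator is at least 1.
  refine MeasureTheory.tendsto_integral_of_dominated_convergence
    (fun t : ℝ => ‖(t : ℂ) ^ (s - 1) * Complex.exp (-(x * t))‖ * 2) ?_ ?_ ?_ ?_
  · intro N
    exact (integrableOn_cpow_mul_exp hs hx).aestronglyMeasurable.mul
      (Continuous.aestronglyMeasurable (by fun_prop))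
  · exact (integrableOn_cpow_mul_exp hs hx).norm.mul_const _
  · intro N
    filter_upwards [MeasureTheory.self_mem_ae_restrict measurableSet_Ioi] with t ht
    rw [norm_mul _ (Finset.sum _ _)]
    refine mul_le_mul_of_nonneg_left ?_ (norm_nonneg _)
    have h1 : Real.exp (-t) ≤ 1 := by rw [Real.exp_le_one_iff]; simpa using (le_of_lt ht)
    have h2 := Real.exp_pos (-t)
    rw [geo, norm_div]
    have e : ‖1 + Complex.exp (-t)‖ = 1 + Real.exp (-t) := by
      have : 1 + Complex.exp (-t) = ((1 + Real.exp (-t) : ℝ) : ℂ) := by push_cast; rfl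
      rw [this, Complex.norm_real, Real.norm_of_nonneg (by positivity)]
    rw [e, div_le_iff₀ (by positivity)]
    calc ‖1 - (-Complex.exp (-t)) ^ N‖ ≤ ‖(1 : ℂ)‖ + ‖(-Complex.exp (-t)) ^ N‖ := norm_sub_le _ _
      _ ≤ 1 + 1 := by
        rw [norm_one, norm_pow, hq]
        gcongr
        exact pow_le_one₀ h2.le h1
      _ ≤ _ := by linarith
  · filter_upwards [MeasureTheory.self_mem_ae_restrict measurableSet_Ioi] with t ht
    simp_rw [geo]
    refine Tendsto.const_mul _ ?_
    have h1 : Real.exp (-t) < 1 := by rw [Real.exp_lt_one_iff]; simpa using ht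
    have := tendsto_pow_atTop_nhds_zero_of_norm_lt_one (x := -Complex.exp (-t)) (by rwa [hq])
    simpa using (this.const_sub 1).div_const (1 + Complex.exp (-t))

theorem hasSum_conditional_iff_tendsto {f : ℕ → ℂ} {a : ℂ} :
    HasSum f a (SummationFilter.conditional ℕ) ↔
      Tendsto (fun N => ∑ n ∈ Finset.range N, f n) atTop (𝓝 a) := by
  rw [HasSum, SummationFilter.conditional_filter_eq_map_range, tendsto_map'_iff]
  rfl

/-- Both sums equal the same integral divided by Γ(s), which does not vanish for Re s > 0. -/
theorem hasSum_hasseFun_and_alternating {s : ℂ} (hs : 0 < s.re) {x : ℝ} (hx : 0 < x) :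
    ∃ a : ℂ, HasSum (fun i => hasseFun x i s) a ∧
      HasSum (fun n : ℕ => (-1 : ℂ) ^ n / ((n : ℂ) + (x : ℂ)) ^ s) a
        (SummationFilter.conditional ℕ) := by
  have hG := Complex.Gamma_ne_zero_of_re_pos hs
  have h1 := (hasSum_gamma_mul_hasseFun hs hx).mul_left (Complex.Gamma s)⁻¹
  have h2 := (tendsto_gamma_mul_alternating hs hx).const_mul (Complex.Gamma s)⁻¹
  simp_rw [inv_mul_cancel_left₀ hG, mul_one_div] at h1 h2
  exact ⟨_, h1, hasSum_conditional_iff_tendsto.2 h2⟩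

theorem hasSum_altHurwitzZeta {s : ℂ} (hs : 0 < s.re) {x : ℝ} (hx : 0 < x) :
    HasSum (fun n : ℕ => (-1 : ℂ) ^ n / ((n : ℂ) + (x : ℂ)) ^ s) (altHurwitzZeta s x)
      (SummationFilter.conditional ℕ) :=
  let ⟨_, _, h⟩ := hasSum_hasseFun_and_alternating hs hx
  h.summable.hasSum

theorem hasSum_hasseFun {s : ℂ} (hs : 0 < s.re) {x : ℝ} (hx : 0 < x) :
    HasSum (fun i => hasseFun x i s) (altHurwitzZeta s x) := by
  obtain ⟨a, h, h'⟩ := hasSum_hasseFun_and_alternating hs hx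
  rwa [(hasSum_altHurwitzZeta hs hx).unique h']

/-! ### Termwise differentiation of the Hasse series. -/

theorem natCast_add_ofReal_ne_zero {x : ℝ} (hx : 0 < x) (j : ℕ) : (j : ℂ) + (x : ℂ) ≠ 0 := by
  have : (j : ℝ) + x ≠ 0 := by positivity
  exact_mod_cast this

theorem differentiable_one_div_cpow {a : ℂ} (ha : a ≠ 0) :
    Differentiable ℂ fun s : ℂ => 1 / a ^ s := fun _ =>
  (differentiableAt_const _).fun_div (differentiableAt_id.const_cpow (Or.inl ha))
    fun h => ha ((Complex.cpow_eq_zero_iff _ _).mp h).1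

theorem iteratedDeriv_one_div_cpow {a : ℂ} (ha : a ≠ 0) (n : ℕ) (s : ℂ) :
    iteratedDeriv n (fun s : ℂ => 1 / a ^ s) s = (-Complex.log a) ^ n * (1 / a ^ s) := by
  have e : (fun s : ℂ => 1 / a ^ s) = fun s => Complex.exp (-Complex.log a * s) := by
    ext s
    rw [Complex.cpow_def_of_ne_zero ha, one_div, ← Complex.exp_neg, neg_mul]
  rw [congrFun e s, e, iteratedDeriv_cexp_const_mul]

theorem differentiable_hasseFun {x : ℝ} (hx : 0 < x) (i : ℕ) :
    Differentiable ℂ (hasseFun x i) := by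
  unfold hasseFun
  refine Differentiable.const_mul (Differentiable.fun_sum fun j _ => ?_) _
  exact (differentiable_one_div_cpow (natCast_add_ofReal_ne_zero hx j)).const_mul _

theorem iteratedDeriv_hasseFun_one {x : ℝ} (hx : 0 < x) (n i : ℕ) :
    iteratedDeriv n (hasseFun x i) 1 = (-1) ^ n * (hasseTerm n x i : ℂ) := by
  have hd := fun j : ℕ => differentiable_one_div_cpow (natCast_add_ofReal_ne_zero hx j)
  unfold hasseFun hasseTerm
  rw [iteratedDeriv_const_mul_field, iteratedDeriv_fun_sum]
  · push_cast
    rw [mul_left_comm ((-1 : ℂ) ^ n), Finset.mul_sum _ _ ((-1 : ℂ) ^ n)]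
    congr 1
    refine Finset.sum_congr rfl fun j _ => ?_
    rw [iteratedDeriv_const_mul_field,
      iteratedDeriv_one_div_cpow (natCast_add_ofReal_ne_zero hx j), Complex.cpow_one]
    have : Complex.log ((j : ℂ) + x) = (Real.log (x + j) : ℂ) := by
      rw [Complex.ofReal_log (by positivity)]; push_cast; rw [add_comm]
    rw [this, neg_pow, add_comm (x : ℂ)]
    ring
  · exact fun j _ => ((hd j).const_mul _).contDiff.contDiffAt

theorem isOpen_re_pos : IsOpen {s : ℂ | 0 < s.re} := isOpen_lt continuous_const Complex.continuous_re

theorem tendstoLocallyUniformlyOn_hasseFun {x : ℝ} (hx : 0 < x) :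
    TendstoLocallyUniformlyOn (fun (t : Finset ℕ) s => ∑ i ∈ t, hasseFun x i s)
      (fun s => altHurwitzZeta s x) atTop {s : ℂ | 0 < s.re} := by
  rw [tendstoLocallyUniformlyOn_iff_forall_isCompact isOpen_re_pos]
  intro K hKU hK
  have hc : ContinuousOn (fun s : ℂ => ((1 / x) ^ s.re * Real.Gamma s.re) / ‖Complex.Gamma s‖) K := by
    intro s hs
    have hs' : 0 < s.re := hKU hs
    refine ContinuousAt.continuousWithinAt ?_
    have hne : ∀ m : ℕ, s ≠ -m := by
      intro m h; rw [h] at hs'; simp at hs'; linarith [Nat.cast_nonneg (α := ℝ) m]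
    have hne' : ∀ m : ℕ, s.re ≠ -m := by
      intro m h; rw [h] at hs'; linarith [Nat.cast_nonneg (α := ℝ) m]
    refine ContinuousAt.div (ContinuousAt.mul ?_ ?_) ?_ ?_
    · exact continuousAt_const.rpow Complex.continuous_re.continuousAt (Or.inl (by positivity))
    · exact ContinuousAt.comp (f := Complex.re)
        (Real.differentiableAt_Gamma hne').continuousAt Complex.continuous_re.continuousAt
    · exact (Complex.differentiableAt_Gamma s hne).continuousAt.norm
    · exact norm_ne_zero_iff.2 (Complex.Gamma_ne_zero_of_re_pos hs')
  obtain ⟨C, hC⟩ := hK.exists_bound_of_continuousOn hc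
  have hu : Summable fun i : ℕ => C * (1 / 2 * (1 / 2 : ℝ) ^ i) :=
    ((summable_geometric_of_lt_one (by norm_num) (by norm_num)).mul_left _).mul_left _
  refine (tendstoUniformlyOn_tsum hu fun i s hs => ?_).congr_right fun s hs =>
    (hasSum_hasseFun (hKU hs) hx).tsum_eq
  refine (norm_hasseFun_le (hKU hs) hx i).trans ?_
  gcongr
  exact (le_abs_self _).trans (hC s hs)

theorem differentiableOn_altHurwitzZeta {x : ℝ} (hx : 0 < x) :
    DifferentiableOn ℂ (fun s => altHurwitzZeta s x) {s : ℂ | 0 < s.re} :=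
  (tendstoLocallyUniformlyOn_hasseFun hx).differentiableOn
    (Eventually.of_forall fun _ => DifferentiableOn.fun_sum fun i _ =>
      (differentiable_hasseFun hx i).differentiableOn) isOpen_re_pos

/-- Weierstrass' theorem for derivatives of all orders. -/
theorem TendstoLocallyUniformlyOn.iteratedDeriv_of_isOpen {ι : Type*} {l : Filter ι}
    {F : ι → ℂ → ℂ} {f : ℂ → ℂ} {U : Set ℂ} (h : TendstoLocallyUniformlyOn F f l U)
    (hF : ∀ i, DifferentiableOn ℂ (F i) U) (hU : IsOpen U) (n : ℕ) :
    TendstoLocallyUniformlyOn (fun i => iteratedDeriv n (F i)) (iteratedDeriv n f) l U := by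
  induction n with
  | zero => simpa using h
  | succ n ih =>
    simp_rw [iteratedDeriv_succ]
    refine ih.deriv (Eventually.of_forall fun i => ?_) hU
    have := ((hF i).analyticOnNhd hU).iterated_deriv n
    rw [← iteratedDeriv_eq_iterate] at this
    exact this.differentiableOn

theorem hasSum_hasseTerm_complex {x : ℝ} (hx : 0 < x) (n : ℕ) :
    HasSum (fun i => (hasseTerm n x i : ℂ))
      ((-1) ^ n * iteratedDeriv n (fun s => altHurwitzZeta s x) 1) := by
  have h := ((tendstoLocallyUniformlyOn_hasseFun hx).iteratedDeriv_of_isOpen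
    (fun t => DifferentiableOn.fun_sum fun i _ =>
      (differentiable_hasseFun hx i).differentiableOn) isOpen_re_pos n).tendsto_at
    (show (1 : ℂ) ∈ {s : ℂ | 0 < s.re} by simp)
  have h' : HasSum (fun i => (-1) ^ n * (hasseTerm n x i : ℂ))
      (iteratedDeriv n (fun s => altHurwitzZeta s x) 1) := by
    refine h.congr fun t => ?_
    rw [iteratedDeriv_fun_sum fun i _ => (differentiable_hasseFun hx i).contDiff.contDiffAt]
    exact Finset.sum_congr rfl fun i _ => iteratedDeriv_hasseFun_one hx n i
  refine (h'.mul_left ((-1) ^ n)).congr_fun fun i => ?_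
  rw [← mul_assoc, ← mul_pow]
  simp

theorem summable_hasseTerm {x : ℝ} (hx : 0 < x) (n : ℕ) : Summable (hasseTerm n x) :=
  Complex.summable_ofReal.1 (hasSum_hasseTerm_complex hx n).summable

theorem iteratedDeriv_altHurwitzZeta_one {x : ℝ} (hx : 0 < x) (n : ℕ) :
    iteratedDeriv n (fun s => altHurwitzZeta s x) 1 =
      (-1) ^ n * ((∑' i : ℕ, hasseTerm n x i : ℝ) : ℂ) := by
  rw [Complex.ofReal_tsum, (hasSum_hasseTerm_complex hx n).tsum_eq, ← mul_assoc, ← mul_pow]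
  simp

/-! ### Even-odd splitting and the Stieltjes constants. -/

theorem hurwitzZetaRegular_of_ne (x : ℝ) {s : ℂ} (hs : s ≠ 1) :
    hurwitzZetaRegular x s = hurwitzZetaPos s x - 1 / (s - 1) :=
  Function.update_of_ne hs _ _

theorem one_div_two_cpow_mul (s : ℂ) {y : ℝ} (hy : 0 < y) (k : ℕ) :
    1 / (2 : ℂ) ^ s * (1 / ((k : ℂ) + (y : ℂ)) ^ s) = 1 / (((2 * k + 2 * y : ℝ)) : ℂ) ^ s := by
  have h := Complex.mul_cpow_ofReal_nonneg (zero_le_two : (0 : ℝ) ≤ 2)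
    (by positivity : 0 ≤ (k : ℝ) + y) s
  rw [one_div_mul_one_div]
  congr 1
  rw [← mul_add, Complex.ofReal_mul, h]
  push_cast
  rfl

/-- Treats two cases at once: c = 1 is the duplication formula, c = -1 the alternating series. -/
theorem hasSum_even_odd_hurwitz {s : ℂ} (hs : 1 < s.re) {x : ℝ} (hx : 0 < x) {c : ℂ}
    (hc : c ^ 2 = 1) :
    HasSum (fun n : ℕ => c ^ n * (1 / ((n : ℂ) + (x : ℂ)) ^ s))
      (1 / 2 ^ s * (hurwitzZetaPos s (x / 2) + c * hurwitzZetaPos s ((1 + x) / 2))) := by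
  rw [mul_add]
  refine HasSum.even_add_odd ?_ ?_
  · refine ((hasSum_hurwitzZetaPos hs (half_pos hx)).mul_left (1 / 2 ^ s)).congr_fun fun k => ?_
    rw [one_div_two_cpow_mul s (half_pos hx), pow_mul, hc, one_pow, one_mul]
    congr 2
    push_cast
    ring
  · rw [mul_left_comm]
    refine (((hasSum_hurwitzZetaPos hs (by positivity : 0 < (1 + x) / 2)).mul_left
      (1 / 2 ^ s)).mul_left c).congr_fun fun k => ?_
    rw [one_div_two_cpow_mul s (by positivity), pow_succ, pow_mul, hc, one_pow, one_mul]
    congr 3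
    push_cast
    ring

theorem hurwitzZetaPos_duplication {s : ℂ} (hs : 1 < s.re) {x : ℝ} (hx : 0 < x) :
    hurwitzZetaPos s x =
      1 / 2 ^ s * (hurwitzZetaPos s (x / 2) + hurwitzZetaPos s ((1 + x) / 2)) := by
  have h := hasSum_even_odd_hurwitz hs hx (one_pow 2)
  simp only [one_pow, one_mul] at h
  exact (hasSum_hurwitzZetaPos hs hx).unique h

theorem altHurwitzZeta_eq_of_one_lt_re {s : ℂ} (hs : 1 < s.re) {x : ℝ} (hx : 0 < x) :
    altHurwitzZeta s x =
      1 / 2 ^ s * (hurwitzZetaPos s (x / 2) - hurwitzZetaPos s ((1 + x) / 2)) := by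
  have h := hasSum_even_odd_hurwitz hs hx (neg_one_sq)
  have h1 := h.tendsto_sum_nat
  have h2 := hasSum_conditional_iff_tendsto.1 (hasSum_altHurwitzZeta (by linarith) hx)
  simp_rw [div_eq_mul_one_div ((-1 : ℂ) ^ _)] at h2
  rw [tendsto_nhds_unique h2 h1]
  ring

/-- The identity theorem on the right half plane. -/
theorem eqOn_re_pos_of_eq_of_one_lt_re {f g : ℂ → ℂ} (hf : DifferentiableOn ℂ f {s | 0 < s.re})
    (hg : DifferentiableOn ℂ g {s | 0 < s.re}) (h : ∀ s : ℂ, 1 < s.re → f s = g s) :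
    Set.EqOn f g {s | 0 < s.re} := by
  refine (hf.analyticOnNhd isOpen_re_pos).eqOn_of_preconnected_of_eventuallyEq
    (hg.analyticOnNhd isOpen_re_pos) (convex_halfSpace_re_gt 0).isPreconnected
    (z₀ := 2) (by simp) ?_
  filter_upwards [(isOpen_lt continuous_const Complex.continuous_re).mem_nhds
    (show (1 : ℝ) < (2 : ℂ).re by simp)] with s hs using h s hs

/-- The terms 1 / (s - 1) cancel in the difference, so the right side is entire and the equality
reaches s = 1. -/
theorem altHurwitzZeta_eqOn {x : ℝ} (hx : 0 < x) :
    Set.EqOn (fun s => altHurwitzZeta s x) (fun s => 1 / 2 ^ s *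
      (hurwitzZetaRegular (x / 2) s - hurwitzZetaRegular ((1 + x) / 2) s)) {s | 0 < s.re} := by
  refine eqOn_re_pos_of_eq_of_one_lt_re (differentiableOn_altHurwitzZeta hx) ?_ fun s hs => ?_
  · exact ((differentiable_one_div_cpow two_ne_zero).mul
      ((differentiable_hurwitzZetaRegular (by positivity)).sub
        (differentiable_hurwitzZetaRegular (by positivity)))).differentiableOn
  · have h1 : s ≠ 1 := by rintro rfl; simp at hs
    rw [hurwitzZetaRegular_of_ne _ h1, hurwitzZetaRegular_of_ne _ h1,
      altHurwitzZeta_eq_of_one_lt_re hs hx]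
    ring

theorem re_pos_mem_nhds_one : {s : ℂ | 0 < s.re} ∈ 𝓝 (1 : ℂ) :=
  isOpen_re_pos.mem_nhds (by simp)

theorem iteratedDeriv_hurwitzZetaRegular_one (k : ℕ) (x : ℝ) :
    iteratedDeriv k (hurwitzZetaRegular x) 1 = (-1) ^ k * stieltjes k x := by
  rw [stieltjes, ← mul_assoc, ← mul_pow]
  simp

theorem iteratedDeriv_altHurwitzZeta_one_eq_stieltjesSum {x : ℝ} (hx : 0 < x) (n : ℕ) :
    iteratedDeriv n (fun s => altHurwitzZeta s x) 1 = (-1) ^ n * stieltjesSum n x := by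
  have hd1 := differentiable_hurwitzZetaRegular (half_pos hx)
  have hd2 := differentiable_hurwitzZetaRegular (by positivity : 0 < (1 + x) / 2)
  rw [((altHurwitzZeta_eqOn hx).eventuallyEq_of_mem re_pos_mem_nhds_one).iteratedDeriv_eq n]
  -- With the factors swapped, the Leibniz index k counts derivatives of the regular parts, as in
  -- `stieltjesSum`.
  have hcomm : (fun s : ℂ => 1 / 2 ^ s *
      (hurwitzZetaRegular (x / 2) s - hurwitzZetaRegular ((1 + x) / 2) s)) = fun s =>
      (hurwitzZetaRegular (x / 2) s - hurwitzZetaRegular ((1 + x) / 2) s) * (1 / 2 ^ s) :=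
    funext fun s => mul_comm _ _
  rw [hcomm]
  rw [iteratedDeriv_fun_mul (hd1.fun_sub hd2).contDiff.contDiffAt
    (differentiable_one_div_cpow two_ne_zero).contDiff.contDiffAt, stieltjesSum, Finset.mul_sum,
    Finset.mul_sum]
  refine Finset.sum_congr rfl fun k hk => ?_
  have hk : k ≤ n := Nat.lt_succ_iff.1 (Finset.mem_range.1 hk)
  rw [iteratedDeriv_fun_sub hd1.contDiff.contDiffAt hd2.contDiff.contDiffAt,
    iteratedDeriv_one_div_cpow two_ne_zero, iteratedDeriv_hurwitzZetaRegular_one,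
    iteratedDeriv_hurwitzZetaRegular_one, Complex.cpow_one, neg_pow, ← Complex.ofReal_ofNat,
    ← Complex.ofReal_log zero_le_two]
  -- The sign (-1)^k comes from the Stieltjes constants and (-1)^(n-k) from differentiating 2^(-s).
  have : (-1 : ℂ) ^ n = (-1) ^ k * (-1) ^ (n - k) := by rw [← pow_add, Nat.add_sub_cancel' hk]
  rw [this]
  push_cast
  ring

/-! ### The case x = 1: log 2, γ and γ₁. -/

theorem hurwitzZetaPos_one (s : ℂ) : hurwitzZetaPos s 1 = riemannZeta s := by
  have : ((1 : ℝ) : UnitAddCircle) = 0 := AddCircle.coe_period 1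
  simp [hurwitzZetaPos, this, HurwitzZeta.hurwitzZeta_zero]

theorem hurwitzZetaRegular_one_one :
    hurwitzZetaRegular 1 1 = (Real.eulerMascheroniConstant : ℂ) := by
  rw [hurwitzZetaRegular, Function.update_self]
  simp_rw [hurwitzZetaPos_one]
  exact tendsto_riemannZeta_sub_one_div.limUnder_eq

/-- The last factor on the right is (s - 1) ζ(s) with its singularity at 1 removed. The duplication
formula at x = 1 eliminates ζ(s, 1/2). -/
theorem sub_one_mul_altHurwitzZeta_eqOn :
    Set.EqOn (fun s => (s - 1) * altHurwitzZeta s 1)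
      (fun s => (1 - 2 * (1 / 2 ^ s)) * ((s - 1) * hurwitzZetaRegular 1 s + 1))
      {s | 0 < s.re} := by
  refine eqOn_re_pos_of_eq_of_one_lt_re ?_ ?_ fun s hs => ?_
  · exact DifferentiableOn.mul (by fun_prop) (differentiableOn_altHurwitzZeta one_pos)
  · have h1 := differentiable_one_div_cpow (two_ne_zero (α := ℂ))
    have h2 := differentiable_hurwitzZetaRegular one_pos
    exact Differentiable.differentiableOn (by fun_prop)
  · have h1 : s - 1 ≠ 0 := by
      intro h; rw [sub_eq_zero.1 h] at hs; simp at hs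
    have h2 := hurwitzZetaPos_duplication hs one_pos
    rw [hurwitzZetaRegular_of_ne _ (sub_ne_zero.1 h1), altHurwitzZeta_eq_of_one_lt_re hs one_pos]
    have h3 : (1 + 1 : ℝ) / 2 = 1 := by norm_num
    rw [h3] at h2 ⊢
    have h4 : (s - 1) * (1 / (s - 1)) = 1 := mul_one_div_cancel h1
    linear_combination (-(s - 1)) * h2 + (1 - 2 * (1 / 2 ^ s)) * h4

/-- The Leibniz rule at `1` for a product with `s - 1`. -/
theorem iteratedDeriv_succ_sub_one_mul {f : ℂ → ℂ} {n : ℕ} (hf : ContDiffAt ℂ (n + 1 : ℕ) f 1) :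
    iteratedDeriv (n + 1) (fun s => (s - 1) * f s) 1 = (n + 1) * iteratedDeriv n f 1 := by
  -- Only the first derivative of s - 1 survives at 1, so the Leibniz sum has a single nonzero term.
  have h1 : ∀ k : ℕ, iteratedDeriv (k + 2) (fun s : ℂ => s - 1) 1 = 0 := by
    intro k
    rw [iteratedDeriv_succ']
    simp [iteratedDeriv_const]
  rw [iteratedDeriv_fun_mul (by fun_prop) hf, Finset.sum_range_succ', Finset.sum_range_succ']
  simp [h1, iteratedDeriv_one]

/-- The term i = 0 vanishes because 1 - 2^(1-s) is zero at s = 1. Hence the n-th derivative of ζ_a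
involves only γ_k with k < n: order 1 yields γ, order 2 yields γ₁. -/
theorem iteratedDeriv_succ_sub_one_mul_altHurwitzZeta (n : ℕ) :
    (n + 1) * iteratedDeriv n (fun s => altHurwitzZeta s 1) 1 =
      ∑ i ∈ Finset.range (n + 1 + 1), ((n + 1).choose i : ℂ) *
        iteratedDeriv i (fun s : ℂ => 1 - 2 * (1 / 2 ^ s)) 1 *
        iteratedDeriv (n + 1 - i) (fun s => (s - 1) * hurwitzZetaRegular 1 s + 1) 1 := by
  have h1 := differentiable_one_div_cpow (two_ne_zero (α := ℂ))
  have h2 := differentiable_hurwitzZetaRegular one_pos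
  rw [← iteratedDeriv_succ_sub_one_mul, (sub_one_mul_altHurwitzZeta_eqOn.eventuallyEq_of_mem
    re_pos_mem_nhds_one).iteratedDeriv_eq, iteratedDeriv_fun_mul]
  · exact Differentiable.contDiff (by fun_prop) |>.contDiffAt
  · exact Differentiable.contDiff (by fun_prop) |>.contDiffAt
  · exact ((differentiableOn_altHurwitzZeta one_pos).analyticAt re_pos_mem_nhds_one).contDiffAt

theorem iteratedDeriv_one_sub_two_cpow (n : ℕ) :
    iteratedDeriv (n + 1) (fun s : ℂ => 1 - 2 * (1 / 2 ^ s)) 1 =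
      -(-(Real.log 2 : ℂ)) ^ (n + 1) := by
  have h1 := differentiable_one_div_cpow (two_ne_zero (α := ℂ))
  rw [iteratedDeriv_fun_sub contDiffAt_const (h1.const_mul 2).contDiff.contDiffAt,
    iteratedDeriv_const_mul_field, iteratedDeriv_one_div_cpow two_ne_zero, Complex.cpow_one,
    Complex.ofReal_log zero_le_two]
  simp [iteratedDeriv_const]
  ring

theorem iteratedDeriv_sub_one_mul_hurwitzZetaRegular (n : ℕ) :
    iteratedDeriv (n + 1) (fun s => (s - 1) * hurwitzZetaRegular 1 s + 1) 1 =
      (n + 1) * ((-1) ^ n * stieltjes n 1) := by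
  have h2 := differentiable_hurwitzZetaRegular one_pos
  rw [iteratedDeriv_fun_add (Differentiable.contDiff (by fun_prop) |>.contDiffAt) contDiffAt_const,
    iteratedDeriv_succ_sub_one_mul h2.contDiff.contDiffAt, iteratedDeriv_hurwitzZetaRegular_one]
  simp [iteratedDeriv_const]

theorem stieltjes_zero_one : stieltjes 0 1 = (Real.eulerMascheroniConstant : ℂ) := by
  simp [stieltjes, hurwitzZetaRegular_one_one]

theorem tsum_hasseTerm_zero_one : ∑' i : ℕ, hasseTerm 0 1 i = Real.log 2 := by
  have h := iteratedDeriv_succ_sub_one_mul_altHurwitzZeta 0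
  have g1 := iteratedDeriv_one_sub_two_cpow 0
  rw [iteratedDeriv_altHurwitzZeta_one one_pos] at h
  simp only [Finset.sum_range_succ, Finset.sum_range_zero, Nat.reduceAdd, Nat.reduceSub,
    iteratedDeriv_zero, Complex.cpow_one] at h g1
  rw [g1] at h
  norm_num at h
  exact_mod_cast h

theorem tsum_hasseTerm_one_one : ∑' i : ℕ, hasseTerm 1 1 i =
    Real.log 2 ^ 2 / 2 - Real.log 2 * Real.eulerMascheroniConstant := by
  have h := iteratedDeriv_succ_sub_one_mul_altHurwitzZeta 1
  have g1 := iteratedDeriv_one_sub_two_cpow 0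
  have g2 := iteratedDeriv_one_sub_two_cpow 1
  have p1 := iteratedDeriv_sub_one_mul_hurwitzZetaRegular 0
  rw [iteratedDeriv_altHurwitzZeta_one one_pos] at h
  simp only [Finset.sum_range_succ, Finset.sum_range_zero, Nat.reduceAdd, Nat.reduceSub,
    iteratedDeriv_zero, Complex.cpow_one] at h g1 g2 p1
  rw [g1, g2, p1, stieltjes_zero_one] at h
  generalize Real.log 2 = L at h ⊢
  generalize ∑' i : ℕ, hasseTerm 1 1 i = S at h ⊢
  norm_num at h
  refine Complex.ofReal_injective ?_
  push_cast
  -- The coefficient inverts (n + 1) (-1)^n at n = 1.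
  linear_combination (-1 / 2 : ℂ) * h

theorem tsum_hasseTerm_two_one : ((∑' i : ℕ, hasseTerm 2 1 i : ℝ) : ℂ) =
    (Real.log 2 : ℂ) ^ 3 / 3 - (Real.log 2 : ℂ) ^ 2 * (Real.eulerMascheroniConstant : ℂ) -
      2 * (Real.log 2 : ℂ) * stieltjes 1 1 := by
  have h := iteratedDeriv_succ_sub_one_mul_altHurwitzZeta 2
  have g1 := iteratedDeriv_one_sub_two_cpow 0
  have g2 := iteratedDeriv_one_sub_two_cpow 1
  have g3 := iteratedDeriv_one_sub_two_cpow 2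
  have p1 := iteratedDeriv_sub_one_mul_hurwitzZetaRegular 0
  have p2 := iteratedDeriv_sub_one_mul_hurwitzZetaRegular 1
  rw [iteratedDeriv_altHurwitzZeta_one one_pos] at h
  simp only [Finset.sum_range_succ, Finset.sum_range_zero, Nat.reduceAdd, Nat.reduceSub,
    iteratedDeriv_zero, Complex.cpow_one] at h g1 g2 g3 p1 p2
  rw [g1, g2, g3, p1, p2, stieltjes_zero_one] at h
  generalize Real.log 2 = L at h ⊢
  generalize ∑' i : ℕ, hasseTerm 2 1 i = S at h ⊢
  norm_num [Nat.choose] at h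
  linear_combination (1 / 3 : ℂ) * h
theorem mainTheorem6 :
    (∀ x : ℝ, 0 < x →
      (∀ s : ℂ, 0 < s.re →
        Summable (fun n : ℕ => (-1 : ℂ) ^ n / ((n : ℂ) + (x : ℂ)) ^ s)
          (SummationFilter.conditional ℕ)) ∧
      DifferentiableOn ℂ (fun s => altHurwitzZeta s x) {s : ℂ | 0 < s.re} ∧
      ∀ n : ℕ,
        iteratedDeriv n (fun s => altHurwitzZeta s x) 1 = (-1) ^ n * stieltjesSum n x ∧
        Summable (hasseTerm n x) ∧
        stieltjesSum n x = ((∑' i : ℕ, hasseTerm n x i : ℝ) : ℂ)) ∧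
    Real.log 2 = ∑' i : ℕ, hasseTerm 0 1 i ∧
    Real.eulerMascheroniConstant =
      1 / 2 * Real.log 2 - 1 / Real.log 2 * ∑' i : ℕ, hasseTerm 1 1 i ∧
    stieltjes 1 1 =
      ((-(1 / 12) * Real.log 2 ^ 2 + 1 / 2 * ∑' i : ℕ, hasseTerm 1 1 i
        - 1 / (2 * Real.log 2) * ∑' i : ℕ, hasseTerm 2 1 i : ℝ) : ℂ) := by
  have hL : Real.log 2 ≠ 0 := (Real.log_pos one_lt_two).ne'
  refine ⟨fun x hx => ⟨fun s hs => (hasSum_altHurwitzZeta hs hx).summable,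
    differentiableOn_altHurwitzZeta hx, fun n => ?_⟩, tsum_hasseTerm_zero_one.symm, ?_, ?_⟩
  · have h := iteratedDeriv_altHurwitzZeta_one_eq_stieltjesSum hx n
    refine ⟨h, summable_hasseTerm hx n, ?_⟩
    rw [iteratedDeriv_altHurwitzZeta_one hx] at h
    exact (mul_left_cancel₀ (pow_ne_zero n (neg_ne_zero.2 one_ne_zero)) h).symm
  · rw [tsum_hasseTerm_one_one]
    field_simp
    ring
  · have hLC : (Real.log 2 : ℂ) ≠ 0 := Complex.ofReal_ne_zero.2 hL
    -- The cast is first pushed only onto S₂, whose value is a complex identity because `stieltjes 1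
    -- 1` is complex; S₁ is replaced as a real number.
    rw [Complex.ofReal_sub, Complex.ofReal_mul (1 / (2 * Real.log 2)), tsum_hasseTerm_two_one,
      tsum_hasseTerm_one_one]
    push_cast
    field_simp
    ring
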